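/- Let $K$ be a field, $n\ge 0$, and let $S=K[x_1,\dots,x_n,y_1,\dots,y_n]$ carry the standard grading. Let $\Delta$ be a simplicial complex of dimension $d-1$ on $[n]=\{1,\dots,n\}$, that is, a collection of subsets of $[n]$ that contains $\emptyset$ and is closed under taking subsets, with $d=\max\{|F| : F\in\Delta\}$. For $G\subseteq[n]$ write $x_G=\prod_{i\in G}x_i$ and $y_G=\prod_{i\in G}y_i$. Let $J_\Delta\subseteq S$ be the ideal generated by the monomials $x_F\,y_{[n]\setminus F}$ with $F\in\Delta$, and let $\overline{\Delta}=\{[n]\setminus F : F\in\Delta\}$. Put $F_0=S$, and for $j\ge 1$ let $F_j$ be the free $S$-module with basis elements $e_{G,H}$ indexed by the pairs with $G\in\Delta$, $H\in\overline{\Delta}$, $|G\cap H|=j-1$ and $G\cup H=[n]$, where $e_{G,H}$ has degree $|G|+|H|=n+j-1$. Let $\partial_1:F_1\to F_0$ be the $S$-linear map with $\partial_1(e_{G,H})=x_Gy_H$, and for $j\ge 2$ let $\partial_j:F_j\to F_{j-1}$ be the $S$-linear map with $$\partial_j(e_{G,H})=\sum_{i\in G\cap H}(-1)^{\sigma(G\cap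 H,i)}\bigl(x_i\,e_{G\setminus\{i\},H}-y_i\,e_{G,H\setminus\{i\}}\bigr),\qquad \sigma(L,i)=|\{j\in L : j<i\}|.$$ Then $F_j=0$ for $j>d+1$, and $$0\to F_{d+1}\xrightarrow{\partial_{d+1}}F_d\to\cdots\to F_2\xrightarrow{\partial_2}F_1\xrightarrow{\partial_1}F_0\to 0$$ is a graded free resolution of $S/J_\Delta$: the $F_j$ are finitely generated graded free $S$-modules, the maps $\partial_j$ and the projection $F_0=S\to S/J_\Delta$ are homogeneous of degree $0$, and the sequence augmented by $F_0\to S/J_\Delta\to 0$ is exact. Moreover, if $n\ge 1$, this resolution is minimal: $\partial_j(F_j)\subseteq (x_1,\dots,x_n,y_1,\dots,y_n)F_{j-1}$ for all $j\ge 1$. -/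

import Mathlib

noncomputable section

namespace FaceIdeal

universe u

/-- A simplicial complex on the vertex set `[n]` (modelled by `Fin n`): a collection of subsets of
`[n]` which contains the empty face and is closed under passing to subsets. Mathlib's
`PreAbstractSimplicialComplex` excludes the empty face, which is needed here. It is not required
that every `{i}` is a face. -/
structure Complex (n : ℕ) where
  faces : Finset (Finset (Fin n))
  empty_mem : ∅ ∈ faces
  down_closed : ∀ F ∈ faces, ∀ G, G ⊆ F → G ∈ faces

namespace Complex

variable {n : ℕ} (Δ : Complex n)

/-- The dimension `max {|F| - 1 : F ∈ Δ}`; it is `-1` for `Δ = {∅}`. -/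
def dim : ℤ := ((Δ.faces.sup Finset.card : ℕ) : ℤ) - 1

/-- The collection of complements `[n] \ F` of the faces `F ∈ Δ`. -/
def complements : Finset (Finset (Fin n)) :=
  Δ.faces.image fun F => Finset.univ \ F

theorem mem_complements {H : Finset (Fin n)} :
    H ∈ Δ.complements ↔ Finset.univ \ H ∈ Δ.faces := by
  unfold complements
  rw [Finset.mem_image]
  constructor
  · rintro ⟨F, hF, rfl⟩
    simpa using hF
  · intro h
    exact ⟨_, h, by simp⟩

end Complex

/-- The polynomial ring `S = K[x_1, …, x_n, y_1, …, y_n]`. -/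
abbrev Poly (n : ℕ) (K : Type u) [Field K] : Type u := MvPolynomial (Fin n ⊕ Fin n) K

section Ring

variable {n : ℕ} (K : Type u) [Field K]

/-- The variable `x_i`. -/
def x (i : Fin n) : Poly n K := MvPolynomial.X (Sum.inl i)

/-- The variable `y_i`. -/
def y (i : Fin n) : Poly n K := MvPolynomial.X (Sum.inr i)

/-- The monomial `x_G`, the product of the `x_i` with `i ∈ G`. -/
def xMon (G : Finset (Fin n)) : Poly n K := ∏ i ∈ G, x K i

/-- The monomial `y_H`, the product of the `y_i` with `i ∈ H`. -/
def yMon (H : Finset (Fin n)) : Poly n K := ∏ i ∈ H, y K i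

/-- The component `S_m` of the standard grading of `S`. -/
def polyGrading (n m : ℕ) : AddSubgroup (Poly n K) :=
  (MvPolynomial.homogeneousSubmodule (Fin n ⊕ Fin n) K m).toAddSubgroup

/-- The component of degree `m` of the shifted module `S(-a)`: it is `S_{m-a}`, and `0` if
`m < a`. -/
def shiftedGrading (n a m : ℕ) : AddSubgroup (Poly n K) :=
  if a ≤ m then polyGrading K n (m - a) else ⊥

/-- The graded maximal ideal `(x_1, …, x_n, y_1, …, y_n)`. -/
def maxIdeal (n : ℕ) : Ideal (Poly n K) :=
  Ideal.span (Set.range (x K) ∪ Set.range (y K))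

/-- The face ideal `J_Δ`, generated by the monomials `u_F = x_F y_{[n] \ F}` with `F ∈ Δ`. -/
def faceIdeal (Δ : Complex n) : Ideal (Poly n K) :=
  Ideal.span {u | ∃ F ∈ Δ.faces, u = xMon K F * yMon K (Finset.univ \ F)}

/-- The grading of `S / J_Δ` by the images of the `S_m`. -/
def quotientGrading (Δ : Complex n) (m : ℕ) : AddSubgroup (Poly n K ⧸ faceIdeal K Δ) :=
  (polyGrading K n m).map (Submodule.mkQ (faceIdeal K Δ)).toAddMonoidHom

end Ring

section Pairs

variable {n : ℕ} (Δ : Complex n)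

/-- The pairs `(G, H)` with `G ∈ Δ`, with `H` the complement of a face, `|G ∩ H| = k` and
`G ∪ H = [n]`. They index the basis of `F_{k+1}`. -/
structure Pair (k : ℕ) where
  G : Finset (Fin n)
  H : Finset (Fin n)
  memG : G ∈ Δ.faces
  memH : H ∈ Δ.complements
  card_inter : (G ∩ H).card = k
  union : G ∪ H = Finset.univ

variable {Δ}

/-- The pair `(G \ {i}, H)`. -/
def Pair.eraseLeft {k : ℕ} (p : Pair Δ (k + 1)) (i : Fin n) (hi : i ∈ p.G ∩ p.H) : Pair Δ k where
  G := p.G.erase i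
  H := p.H
  memG := Δ.down_closed _ p.memG _ (Finset.erase_subset _ _)
  memH := p.memH
  card_inter := by
    rw [Finset.erase_inter, Finset.card_erase_of_mem hi, p.card_inter, Nat.add_sub_cancel]
  union := by
    ext a
    have h : a ∈ p.G ∪ p.H := by rw [p.union]; exact Finset.mem_univ a
    have h2 := (Finset.mem_inter.mp hi).2
    by_cases hai : a = i
    · subst hai; simp [h2]
    · simpa [hai] using h

/-- The pair `(G, H \ {i})`. -/
def Pair.eraseRight {k : ℕ} (p : Pair Δ (k + 1)) (i : Fin n) (hi : i ∈ p.G ∩ p.H) : Pair Δ k where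
  G := p.G
  H := p.H.erase i
  memG := p.memG
  memH := by
    rw [Complex.mem_complements]
    refine Δ.down_closed _ p.memG _ ?_
    intro a ha
    have h : a ∈ p.G ∪ p.H := by rw [p.union]; exact Finset.mem_univ a
    have h1 := (Finset.mem_inter.mp hi).1
    by_cases hai : a = i
    · subst hai; exact h1
    · have ha' : a ∉ p.H := by simpa [hai] using ha
      simpa [ha'] using h
  card_inter := by
    rw [Finset.inter_erase, Finset.card_erase_of_mem hi, p.card_inter, Nat.add_sub_cancel]
  union := by
    ext a
    have h : a ∈ p.G ∪ p.H := by rw [p.union]; exact Finset.mem_univ a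
    have h1 := (Finset.mem_inter.mp hi).1
    by_cases hai : a = i
    · subst hai; simp [h1]
    · simpa [hai] using h

/-- `σ(L, i)`, the number of `j ∈ L` with `j < i`. -/
def sigma (L : Finset (Fin n)) (i : Fin n) : ℕ := (L.filter fun j => j < i).card

end Pairs

section Resolution

variable {n : ℕ} (K : Type u) [Field K] (Δ : Complex n)

/-- The modules `F_0 = S` and, for `j = k + 1 ≥ 1`, the free `S`-module `F_j` on the pairs `(G, H)`
with `|G ∩ H| = j - 1`. -/
def F : ℕ → Type u
  | 0 => Poly n K
  | k + 1 => Pair Δ k →₀ Poly n K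

instance instAddCommGroupF : ∀ j, AddCommGroup (F K Δ j)
  | 0 => inferInstanceAs (AddCommGroup (Poly n K))
  | k + 1 => inferInstanceAs (AddCommGroup (Pair Δ k →₀ Poly n K))

instance instModuleF : ∀ j, Module (Poly n K) (F K Δ j)
  | 0 => inferInstanceAs (Module (Poly n K) (Poly n K))
  | k + 1 => inferInstanceAs (Module (Poly n K) (Pair Δ k →₀ Poly n K))

/-- The basis element `e_{G,H}` of `F_{k+1}`. -/
def e {k : ℕ} (p : Pair Δ k) : Pair Δ k →₀ Poly n K := Finsupp.single p 1

/-- `∂_1 : F_1 → F_0 = S`, the linear map with `e_{G,H} ↦ x_G y_H`. -/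
def boundaryOne : (Pair Δ 0 →₀ Poly n K) →ₗ[Poly n K] Poly n K :=
  Finsupp.linearCombination (Poly n K) fun p => xMon K p.G * yMon K p.H

/-- `∂_j : F_j → F_{j-1}` for `j = k + 2 ≥ 2`, the linear map sending `e_{G,H}` to the sum over
`i ∈ G ∩ H` of `(-1)^{σ(G ∩ H, i)} (x_i e_{G \ {i}, H} - y_i e_{G, H \ {i}})`. -/
def boundarySucc (k : ℕ) :
    (Pair Δ (k + 1) →₀ Poly n K) →ₗ[Poly n K] (Pair Δ k →₀ Poly n K) :=
  Finsupp.linearCombination (Poly n K) fun p =>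
    ∑ i : {i // i ∈ p.G ∩ p.H},
      (-1 : Poly n K) ^ sigma (p.G ∩ p.H) i.1 •
        (x K i.1 • e K Δ (p.eraseLeft i.1 i.2) - y K i.1 • e K Δ (p.eraseRight i.1 i.2))

/-- The differential; `boundary K Δ j` is `∂_{j+1} : F_{j+1} → F_j`. -/
def boundary : ∀ j, F K Δ (j + 1) →ₗ[Poly n K] F K Δ j
  | 0 => boundaryOne K Δ
  | k + 1 => boundarySucc K Δ k

/-- The augmentation `F_0 = S → S / J_Δ`. -/
def augmentation : F K Δ 0 →ₗ[Poly n K] (Poly n K ⧸ faceIdeal K Δ) :=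
  Submodule.mkQ (faceIdeal K Δ)

/-- The direct sum grading of `⨁ S(-(|G| + |H|))`, in which `e_{G,H}` has degree `|G| + |H|`
(this is the degree of `x_G y_H`, and it equals `n + k`). -/
def pairGrading (k m : ℕ) : AddSubgroup (Pair Δ k →₀ Poly n K) where
  carrier := {f | ∀ p, f p ∈ shiftedGrading K n (p.G.card + p.H.card) m}
  zero_mem' := fun _ => zero_mem _
  add_mem' := fun hf hg p => add_mem (hf p) (hg p)
  neg_mem' := fun hf p => neg_mem (hf p)

/-- The grading of `F_j`: the standard one on `F_0 = S`, and the one with `e_{G,H}` in degree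
`|G| + |H|` on `F_j` for `j ≥ 1`. -/
def grading : ∀ j, ℕ → AddSubgroup (F K Δ j)
  | 0 => polyGrading K n
  | k + 1 => pairGrading K Δ k

end Resolution

/-- `ℳ` makes `M` a graded module over the ring `S` with grading `𝒮`. -/
structure IsGradedModule {S : Type*} [CommRing S] (𝒮 : ℕ → AddSubgroup S)
    {M : Type*} [AddCommGroup M] [Module S M] (ℳ : ℕ → AddSubgroup M) : Prop where
  smul_mem : ∀ (i j : ℕ) (s : S) (m : M), s ∈ 𝒮 i → m ∈ ℳ j → s • m ∈ ℳ (i + j)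
  isInternal : DirectSum.IsInternal ℳ

/-- `⋯ → F_2 → F_1 → F_0 → M → 0` is a graded free resolution of the graded module `M`: each `F_j`
is a graded module with a finite basis of homogeneous elements, all the maps preserve degrees, and
the sequence is exact. -/
structure IsGradedFreeResolution {S : Type*} [CommRing S] (𝒮 : ℕ → AddSubgroup S)
    {F : ℕ → Type*} [∀ j, AddCommGroup (F j)] [∀ j, Module S (F j)]
    (𝓕 : ∀ j, ℕ → AddSubgroup (F j)) (bd : ∀ j, F (j + 1) →ₗ[S] F j)
    {M : Type*} [AddCommGroup M] [Module S M] (ℳ : ℕ → AddSubgroup M)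
    (ε : F 0 →ₗ[S] M) : Prop where
  graded_target : IsGradedModule 𝒮 ℳ
  graded : ∀ j, IsGradedModule 𝒮 (𝓕 j)
  free : ∀ j, ∃ (r : ℕ) (b : Module.Basis (Fin r) S (F j)) (deg : Fin r → ℕ),
    ∀ i, b i ∈ 𝓕 j (deg i)
  boundary_mem : ∀ j m, ∀ f ∈ 𝓕 (j + 1) m, bd j f ∈ 𝓕 j m
  augmentation_mem : ∀ m, ∀ f ∈ 𝓕 0 m, ε f ∈ ℳ m
  exact : ∀ j, Function.Exact (bd (j + 1)) (bd j)
  exact_zero : Function.Exact (bd 0) ε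
  surjective : Function.Surjective ε

end FaceIdeal

end

/-!
The main point is exactness. Identify the pair `(G, H)` with the interval `[[n] \ H, G]` in the
face poset of `Δ`. This is a cube of dimension `|G ∩ H|`, and `∂_j` for `j ≥ 2` is the cellular
differential of the resulting cube complex, each facet being weighted by a variable. Deleting a
vertex `i` maps `Δ` to itself, and moving every face `A` to `A \ {i}` along the edge
`[A \ {i}, A]` is a homotopy from the identity to this deletion.

In algebraic terms, let `D_i` be the additive operator on `S` that divides by `y_i` the monomials
which `y_i` divides and kills the others (`divY`). The additive map `h_i` (`homotopy`) sends
`c e_{G,H}` to `± D_i(c) e_{G, H ∪ {i}}` if `i ∈ G \ H`, and to `0` otherwise. A computation on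
the terms `c e_{G,H}` shows that `π_i = 1 - ∂ h_i - h_i ∂` (`retract`) is

* the identity if `i ∉ G`;
* zero if `i ∈ G ∩ H`;
* `c e_{G,H} ↦ x_i D_i(c) e_{G \ {i}, H ∪ {i}} + (c - y_i D_i(c)) e_{G,H}` if `i ∈ G \ H`.

Hence, applying the `π_i` one after the other (`retract_mem_reduced`), every cycle is homologous to
a combination of terms `m e_{G,H}`, with `m` a monomial, such that every `i ∈ G` satisfies `i ∉ H`
and `y_i ∤ m` (`exists_sub_del_mem_reduced`). In `F_j` with `j ≥ 2` there is no such term, because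
`G ∩ H ≠ ∅`. In `F_1`, where `H = [n] \ G`, the product `m x_G y_H` determines the term
`m e_{G,H}`, as `H` is the set of all `i` such that `y_i` divides the product; so `∂_1` is injective
on these combinations (`eq_zero_of_mem_reduced_zero`).

The signs and the identity `∂ ∂ = 0` are handled in the free module on all pairs of subsets of
`[n]`, in which every `F_j` with `j ≥ 1` embeds; `Δ` plays no role there. The gradings are internal
by a criterion on projections (`isInternal_of_projections`), applied to homogeneous components.
-/

namespace FaceIdeal

section FreePairs

/-! ### Signs -/

variable {n : ℕ}

theorem sigma_insert {L : Finset (Fin n)} {i : Fin n} (hi : i ∉ L) (j : Fin n) :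
    sigma (insert i L) j = sigma L j + if i < j then 1 else 0 := by
  unfold sigma
  rw [Finset.filter_insert]
  split_ifs with h
  · rw [Finset.card_insert_of_notMem (by simp [hi])]
  · rfl

theorem sigma_erase {L : Finset (Fin n)} {j : Fin n} (hj : j ∈ L) (i : Fin n) :
    sigma L i = sigma (L.erase j) i + if j < i then 1 else 0 := by
  conv_lhs => rw [← Finset.insert_erase hj]
  exact sigma_insert (Finset.notMem_erase j L) i

/-- The sign `(-1)^{σ(L, i)}`, as an integer so that it passes through every additive map. -/
def sgn (L : Finset (Fin n)) (i : Fin n) : ℤ := (-1) ^ sigma L i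

theorem sgn_mul_self (L : Finset (Fin n)) (i : Fin n) : sgn L i * sgn L i = 1 := by
  unfold sgn
  rw [← mul_pow]
  simp

theorem sgn_insert_self {L : Finset (Fin n)} {i : Fin n} (hi : i ∉ L) :
    sgn (insert i L) i = sgn L i := by
  simp [sgn, sigma_insert hi]

theorem sgn_erase_swap {L : Finset (Fin n)} {i j : Fin n} (hi : i ∈ L) (hj : j ∈ L)
    (hij : i ≠ j) : sgn L i * sgn (L.erase i) j = -(sgn L j * sgn (L.erase j) i) := by
  unfold sgn
  rw [sigma_erase hj i, sigma_erase hi j]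
  rcases lt_or_gt_of_ne hij with h | h
  · simp only [h, h.not_gt, if_true, if_false, pow_add]; ring
  · simp only [h, h.not_gt, if_true, if_false, pow_add]; ring

theorem sgn_insert_swap {L : Finset (Fin n)} {i j : Fin n} (hi : i ∉ L) (hj : j ∈ L) :
    sgn L i * sgn (insert i L) j = -(sgn L j * sgn (L.erase j) i) := by
  have hij : i ≠ j := fun h => hi (h ▸ hj)
  have h := sgn_erase_swap (Finset.mem_insert_self i L) (Finset.mem_insert_of_mem hj) hij
  have h2 : sgn ((insert i L).erase j) i = sgn (L.erase j) i := by
    rw [Finset.erase_insert_of_ne hij, sgn_insert_self (by simp [hi])]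
  rw [sgn_insert_self hi, Finset.erase_insert hi, h2] at h
  linear_combination sgn (insert i L) j * sgn L j * h
    - sgn L i * sgn (insert i L) j * sgn_mul_self L j
    - sgn L j * sgn (L.erase j) i * sgn_mul_self (insert i L) j

/-! ### Division by a variable -/

variable (K : Type*) [Field K]

/-- The operator `D_i` on `S` which divides by `y_i` the monomials that `y_i` divides, and kills
the other ones. It is additive, but not `S`-linear. -/
noncomputable def divY (i : Fin n) : Poly n K →+ Poly n K :=
  AddMonoidHom.mk' (fun f => MvPolynomial.divMonomial f (Finsupp.single (Sum.inr i) 1))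
    fun f g => MvPolynomial.add_divMonomial f g _

theorem coeff_divY (i : Fin n) (f : Poly n K) (m : Fin n ⊕ Fin n →₀ ℕ) :
    (divY K i f).coeff m = f.coeff (Finsupp.single (Sum.inr i) 1 + m) :=
  MvPolynomial.coeff_divMonomial _ _ _

theorem divY_mul_X {i : Fin n} {v : Fin n ⊕ Fin n} (hv : v ≠ Sum.inr i) (f : Poly n K) :
    divY K i (f * MvPolynomial.X v) = divY K i f * MvPolynomial.X v := by
  ext m
  rw [coeff_divY, MvPolynomial.coeff_mul_X', MvPolynomial.coeff_mul_X']
  have hm : v ∈ (Finsupp.single (Sum.inr i) 1 + m).support ↔ v ∈ m.support := by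
    simp [hv.symm]
  simp only [hm]
  split_ifs with h
  · rw [coeff_divY, add_tsub_assoc_of_le]
    rw [Finsupp.single_le_iff]
    exact Nat.one_le_iff_ne_zero.mpr (Finsupp.mem_support_iff.mp h)
  · rfl

theorem divY_mul_x (i j : Fin n) (f : Poly n K) : divY K i (f * x K j) = divY K i f * x K j :=
  divY_mul_X K (by simp) f

theorem divY_mul_y {i j : Fin n} (h : j ≠ i) (f : Poly n K) :
    divY K i (f * y K j) = divY K i f * y K j :=
  divY_mul_X K (by simpa using h) f

theorem divY_mul_y_self (i : Fin n) (f : Poly n K) : divY K i (f * y K i) = f := by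
  ext m
  rw [coeff_divY, add_comm]
  exact MvPolynomial.coeff_mul_X _ _ _

theorem divY_comm (i j : Fin n) (f : Poly n K) :
    divY K i (divY K j f) = divY K j (divY K i f) := by
  ext m
  simp only [coeff_divY, ← add_assoc]
  rw [add_comm (Finsupp.single (Sum.inr i) 1)]

/-! ### The complex on all pairs of subsets -/

/-- The free `S`-module on all pairs of subsets of `[n]`. For every `Δ` and every `j ≥ 1` the
module `F_j` sits in it as the span of some of the basis elements. -/
abbrev FreePairs (n : ℕ) (K : Type*) [Field K] : Type _ :=
  (Finset (Fin n) × Finset (Fin n)) →₀ Poly n K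

/-- The summand of `∂(c e_{G,H})` belonging to `i ∈ G ∩ H`, without its sign. -/
noncomputable def face (q : Finset (Fin n) × Finset (Fin n)) (c : Poly n K) (i : Fin n) :
    FreePairs n K :=
  Finsupp.single (q.1.erase i, q.2) (c * x K i) - Finsupp.single (q.1, q.2.erase i) (c * y K i)

/-- The differential on the free module on all pairs; it restricts to `∂_j` for `j ≥ 2`. -/
noncomputable def del : FreePairs n K →ₗ[Poly n K] FreePairs n K :=
  Finsupp.linearCombination (Poly n K) fun q => ∑ i ∈ q.1 ∩ q.2, sgn (q.1 ∩ q.2) i • face K q 1 i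

/-- The map `e_{G,H} ↦ x_G y_H` on the free module on all pairs. -/
noncomputable def eps : FreePairs n K →ₗ[Poly n K] Poly n K :=
  Finsupp.linearCombination (Poly n K) fun q => xMon K q.1 * yMon K q.2

theorem smul_face (q : Finset (Fin n) × Finset (Fin n)) (c : Poly n K) (i : Fin n) :
    c • face K q 1 i = face K q c i := by
  simp [face, smul_sub, Finsupp.smul_single]

theorem del_single (q : Finset (Fin n) × Finset (Fin n)) (c : Poly n K) :
    del K (Finsupp.single q c) = ∑ i ∈ q.1 ∩ q.2, sgn (q.1 ∩ q.2) i • face K q c i := by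
  simp only [del, Finsupp.linearCombination_single, Finset.smul_sum]
  refine Finset.sum_congr rfl fun i _ => ?_
  rw [smul_comm, smul_face]

theorem eps_single (q : Finset (Fin n) × Finset (Fin n)) (c : Poly n K) :
    eps K (Finsupp.single q c) = c * (xMon K q.1 * yMon K q.2) := by
  simp [eps]

theorem eps_del (f : FreePairs n K) : eps K (del K f) = 0 := by
  induction f using Finsupp.induction_linear with
  | zero => simp
  | add f g hf hg => rw [map_add, map_add, hf, hg, add_zero]
  | single q c =>
    rw [del_single, map_sum]
    refine Finset.sum_eq_zero fun i hi => ?_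
    rw [Finset.mem_inter] at hi
    have h1 : x K i * xMon K (q.1.erase i) = xMon K q.1 := Finset.mul_prod_erase _ _ hi.1
    have h2 : y K i * yMon K (q.2.erase i) = yMon K q.2 := Finset.mul_prod_erase _ _ hi.2
    have h : eps K (face K q c i) = 0 := by
      rw [face, map_sub, eps_single, eps_single]
      simp only
      rw [← h1, ← h2]
      ring
    rw [map_zsmul, h, smul_zero]

theorem del_face {q : Finset (Fin n) × Finset (Fin n)} (c : Poly n K) {i : Fin n} :
    del K (face K q c i) = ∑ j ∈ (q.1 ∩ q.2).erase i, sgn ((q.1 ∩ q.2).erase i) j •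
      (face K (q.1.erase i, q.2) (c * x K i) j - face K (q.1, q.2.erase i) (c * y K i) j) := by
  rw [face, map_sub, del_single, del_single]
  simp only [Finset.erase_inter, Finset.inter_erase]
  rw [← Finset.sum_sub_distrib]
  exact Finset.sum_congr rfl fun j _ => (smul_sub _ _ _).symm

theorem del_del (f : FreePairs n K) : del K (del K f) = 0 := by
  induction f using Finsupp.induction_linear with
  | zero => simp
  | add f g hf hg => rw [map_add, map_add, hf, hg, add_zero]
  | single q c =>
    rw [del_single, map_sum]
    simp only [map_zsmul, del_face, Finset.smul_sum]
    rw [Finset.sum_sigma']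
    -- The double faces for `(i, j)` and `(j, i)` agree up to the sign.
    refine Finset.sum_involution (fun a _ => ⟨a.2, a.1⟩) ?_ ?_ ?_ ?_
    · rintro ⟨i, j⟩ h
      simp only [Finset.mem_sigma, Finset.mem_erase] at h
      obtain ⟨hi, hji, hj⟩ := h
      simp only [smul_smul]
      rw [sgn_erase_swap hi hj hji.symm, neg_smul, neg_add_eq_zero]
      congr 1
      simp only [face]
      rw [Finset.erase_right_comm (a := i), Finset.erase_right_comm (s := q.2) (a := i)]
      rw [mul_right_comm c (x K i), mul_right_comm c (y K i) (y K j),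
        mul_right_comm c (y K i) (x K j), mul_right_comm c (x K i) (y K j)]
      abel
    · rintro ⟨i, j⟩ h _ he
      simp only [Finset.mem_sigma, Finset.mem_erase] at h
      simp only [Sigma.mk.injEq, heq_eq_eq] at he
      exact h.2.1 he.1
    · rintro ⟨i, j⟩ h
      simp only [Finset.mem_sigma, Finset.mem_erase] at h ⊢
      exact ⟨h.2.2, h.2.1.symm, h.1⟩
    · rintro ⟨i, j⟩ _
      rfl

/-! ### The homotopies -/

/-- The homotopy `h_i`. For `i ∈ G \ H` it sends `c e_{G,H}` to `∓ D_i(c) e_{G, H ∪ {i}}`, and it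
kills the other terms. In terms of the interval `[[n] \ H, G]`, it sweeps out a cube by deleting
`i` from all of its members. -/
noncomputable def homotopy (i : Fin n) : FreePairs n K →+ FreePairs n K :=
  Finsupp.liftAddHom fun q =>
    if i ∈ q.1 ∧ i ∉ q.2 then
      (Finsupp.singleAddHom (q.1, insert i q.2)).comp (-sgn (q.1 ∩ q.2) i • divY K i)
    else 0

theorem homotopy_single_of_mem {i : Fin n} {q : Finset (Fin n) × Finset (Fin n)} (h1 : i ∈ q.1)
    (h2 : i ∉ q.2) (c : Poly n K) : homotopy K i (Finsupp.single q c) =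
      -sgn (q.1 ∩ q.2) i • Finsupp.single (q.1, insert i q.2) (divY K i c) := by
  rw [homotopy, Finsupp.liftAddHom_apply_single, if_pos ⟨h1, h2⟩, AddMonoidHom.comp_apply,
    AddMonoidHom.smul_apply, map_zsmul]
  rfl

theorem homotopy_single_of_not {i : Fin n} {q : Finset (Fin n) × Finset (Fin n)}
    (h : ¬(i ∈ q.1 ∧ i ∉ q.2)) (c : Poly n K) : homotopy K i (Finsupp.single q c) = 0 := by
  rw [homotopy, Finsupp.liftAddHom_apply_single, if_neg h, AddMonoidHom.zero_apply]

/-- The map `π_i = 1 - ∂ h_i - h_i ∂`, which is homotopic to the identity. -/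
noncomputable def retract (i : Fin n) (f : FreePairs n K) : FreePairs n K :=
  f - del K (homotopy K i f) - homotopy K i (del K f)

theorem retract_single_of_notMem {i : Fin n} {q : Finset (Fin n) × Finset (Fin n)} (h : i ∉ q.1)
    (c : Poly n K) : retract K i (Finsupp.single q c) = Finsupp.single q c := by
  rw [retract, homotopy_single_of_not K (fun hh => h hh.1), del_single, map_sum,
    Finset.sum_eq_zero, map_zero, sub_zero, sub_zero]
  intro j _
  rw [map_zsmul, face, map_sub, homotopy_single_of_not K (by simp [h]),
    homotopy_single_of_not K (by simp [h]), sub_zero, smul_zero]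

theorem retract_single_of_mem_inter {i : Fin n} {q : Finset (Fin n) × Finset (Fin n)}
    (h1 : i ∈ q.1) (h2 : i ∈ q.2) (c : Poly n K) : retract K i (Finsupp.single q c) = 0 := by
  have hi : i ∈ q.1 ∩ q.2 := Finset.mem_inter.mpr ⟨h1, h2⟩
  rw [retract, homotopy_single_of_not K (fun hh => hh.2 h2), del_single, map_sum,
    Finset.sum_eq_single_of_mem i hi]
  · -- Only the face `e_{G, H \ {i}}` survives, and `h_i` takes it back to `e_{G,H}`.
    rw [map_zsmul, face, map_sub, homotopy_single_of_not K (by simp),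
      homotopy_single_of_mem K (q := (q.1, q.2.erase i)) h1 (by simp), divY_mul_y_self]
    simp only [Finset.inter_erase, Finset.insert_erase h2]
    have hs : sgn ((q.1 ∩ q.2).erase i) i = sgn (q.1 ∩ q.2) i := by
      conv_rhs => rw [← Finset.insert_erase hi]
      rw [sgn_insert_self (Finset.notMem_erase _ _)]
    rw [hs, zero_sub, neg_smul, neg_neg, smul_smul, sgn_mul_self, one_smul, map_zero]
    simp
  · intro j _ hj
    rw [map_zsmul, face, map_sub, homotopy_single_of_not K (by simp [h2]),
      homotopy_single_of_not K (by simp [h2, hj.symm]), sub_zero, smul_zero]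

theorem retract_single_of_mem_sdiff {i : Fin n} {q : Finset (Fin n) × Finset (Fin n)}
    (h1 : i ∈ q.1) (h2 : i ∉ q.2) (c : Poly n K) : retract K i (Finsupp.single q c) =
      Finsupp.single (q.1.erase i, insert i q.2) (divY K i c * x K i) +
        Finsupp.single q (c - divY K i c * y K i) := by
  have hi : i ∉ q.1 ∩ q.2 := fun h => h2 (Finset.mem_inter.mp h).2
  rw [retract, homotopy_single_of_mem K h1 h2, map_zsmul, del_single, del_single, map_sum]
  simp only [Finset.inter_insert_of_mem h1]
  rw [Finset.sum_insert hi, smul_add, Finset.smul_sum, sub_sub, add_assoc,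
    ← Finset.sum_add_distrib, Finset.sum_eq_zero, add_zero, sgn_insert_self hi, smul_smul,
    neg_mul, sgn_mul_self, neg_one_smul, face, Finset.erase_insert h2, Finsupp.single_sub]
  · simp only [Prod.mk.eta]
    abel
  · intro j hj
    have hij : i ≠ j := fun h => hi (h ▸ hj)
    rw [map_zsmul, smul_smul, neg_mul, sgn_insert_swap hi hj, neg_neg]
    simp only [face]
    rw [map_sub, homotopy_single_of_mem K (by simp [h1, hij]) (by simpa using h2),
      homotopy_single_of_mem K (by simpa using h1) (by simp [h2]), divY_mul_x,
      divY_mul_y K hij.symm]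
    simp only [Finset.erase_inter, Finset.inter_erase, Finset.erase_insert_of_ne hij]
    simp only [smul_sub, neg_smul, smul_neg, smul_smul]
    abel

end FreePairs

section Exactness

/-! ### Reduced cycles -/

variable {n : ℕ} (K : Type*) [Field K] (Δ : Complex n)

/-- The condition on `(G, H)` under which `e_{G,H}` is a basis element of `F_{k+1}`. -/
structure IsPair (k : ℕ) (q : Finset (Fin n) × Finset (Fin n)) : Prop where
  memG : q.1 ∈ Δ.faces
  memH : q.2 ∈ Δ.complements
  card_inter : (q.1 ∩ q.2).card = k
  union : q.1 ∪ q.2 = Finset.univ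

variable {Δ}

theorem IsPair.insert_right {k : ℕ} {q : Finset (Fin n) × Finset (Fin n)} (hq : IsPair Δ k q)
    {i : Fin n} (h1 : i ∈ q.1) (h2 : i ∉ q.2) : IsPair Δ (k + 1) (q.1, insert i q.2) where
  memG := hq.memG
  memH := by
    have := hq.memH
    rw [Complex.mem_complements] at this ⊢
    exact Δ.down_closed _ this _ (Finset.sdiff_subset_sdiff subset_rfl (Finset.subset_insert _ _))
  card_inter := by
    rw [Finset.inter_insert_of_mem h1, Finset.card_insert_of_notMem (by simp [h2]), hq.card_inter]
  union := by rw [Finset.union_insert, hq.union, Finset.insert_eq_of_mem (Finset.mem_univ i)]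

theorem IsPair.shift {k : ℕ} {q : Finset (Fin n) × Finset (Fin n)} (hq : IsPair Δ k q)
    {i : Fin n} (h1 : i ∈ q.1) (h2 : i ∉ q.2) : IsPair Δ k (q.1.erase i, insert i q.2) where
  memG := Δ.down_closed _ hq.memG _ (Finset.erase_subset _ _)
  memH := (hq.insert_right h1 h2).memH
  card_inter := by
    rw [Finset.inter_insert_of_notMem (Finset.notMem_erase _ _), Finset.erase_inter,
      Finset.erase_eq_of_notMem (by simp [h2]), hq.card_inter]
  union := by
    rw [Finset.union_insert, ← Finset.insert_union, Finset.insert_erase h1, hq.union]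

variable (Δ)

/-- The elements of `F_{k+1}` which, for every `i ∈ T`, only involve terms `m e_{G,H}`, with `m` a
monomial, such that `i ∉ G`, or else `i ∉ H` and `y_i ∤ m`. For `i ∈ T` these are the terms that
`π_i` fixes; for `T = ∅` this is all of `F_{k+1}`. -/
def reduced (k : ℕ) (T : Finset (Fin n)) : AddSubgroup (FreePairs n K) where
  carrier := {f | ∀ q, (¬IsPair Δ k q → f q = 0) ∧
    ∀ i ∈ T, i ∈ q.1 → (i ∈ q.2 → f q = 0) ∧ divY K i (f q) = 0}
  zero_mem' := by simp
  add_mem' := by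
    intro f g hf hg q
    refine ⟨fun h => ?_, fun i hi h1 => ⟨fun h2 => ?_, ?_⟩⟩
    · rw [Finsupp.add_apply, (hf q).1 h, (hg q).1 h, add_zero]
    · rw [Finsupp.add_apply, ((hf q).2 i hi h1).1 h2, ((hg q).2 i hi h1).1 h2, add_zero]
    · rw [Finsupp.add_apply, map_add, ((hf q).2 i hi h1).2, ((hg q).2 i hi h1).2, add_zero]
  neg_mem' := by
    intro f hf q
    refine ⟨fun h => ?_, fun i hi h1 => ⟨fun h2 => ?_, ?_⟩⟩
    · rw [Finsupp.neg_apply, (hf q).1 h, neg_zero]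
    · rw [Finsupp.neg_apply, ((hf q).2 i hi h1).1 h2, neg_zero]
    · rw [Finsupp.neg_apply, map_neg, ((hf q).2 i hi h1).2, neg_zero]

variable {K Δ}

theorem single_mem_reduced {k : ℕ} {T : Finset (Fin n)} {q : Finset (Fin n) × Finset (Fin n)}
    {c : Poly n K} (hq : IsPair Δ k q) (h : ∀ i ∈ T, i ∈ q.1 → i ∉ q.2 ∧ divY K i c = 0) :
    Finsupp.single q c ∈ reduced K Δ k T := by
  intro q'
  by_cases hqq : q = q'
  · subst hqq
    simp only [Finsupp.single_eq_same]
    exact ⟨fun h' => absurd hq h', fun i hi h1 => ⟨fun h2 => absurd h2 (h i hi h1).1,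
      (h i hi h1).2⟩⟩
  · simp [Finsupp.single_eq_of_ne (Ne.symm hqq)]

/-- To prove something additive about the elements of `reduced K Δ k T`, it is enough to treat its
elements of the form `c e_{G,H}`. -/
theorem reduced_induction {k : ℕ} {T : Finset (Fin n)} {P : FreePairs n K → Prop}
    (zero : P 0) (add : ∀ f g, P f → P g → P (f + g))
    (single : ∀ q c, IsPair Δ k q → (∀ i ∈ T, i ∈ q.1 → i ∉ q.2 ∧ divY K i c = 0) →
      P (Finsupp.single q c)) {f : FreePairs n K} (hf : f ∈ reduced K Δ k T) : P f := by
  rw [← Finsupp.sum_single f, Finsupp.sum]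
  refine Finset.sum_induction _ P add zero fun q hq => ?_
  rw [Finsupp.mem_support_iff] at hq
  refine single _ _ (not_not.mp fun h => hq ((hf q).1 h)) fun i hi h1 => ?_
  exact ⟨fun h2 => hq (((hf q).2 i hi h1).1 h2), ((hf q).2 i hi h1).2⟩

theorem homotopy_mem_reduced {k : ℕ} {T : Finset (Fin n)} (i : Fin n) {f : FreePairs n K}
    (hf : f ∈ reduced K Δ k T) : homotopy K i f ∈ reduced K Δ (k + 1) ∅ := by
  refine reduced_induction (P := fun f => homotopy K i f ∈ reduced K Δ (k + 1) ∅)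
    (by simp) (fun f g hf hg => ?_) (fun q c hq _ => ?_) hf
  · rw [map_add]
    exact add_mem hf hg
  · by_cases h : i ∈ q.1 ∧ i ∉ q.2
    · rw [homotopy_single_of_mem K h.1 h.2]
      exact zsmul_mem (single_mem_reduced (hq.insert_right h.1 h.2) (by simp)) _
    · rw [homotopy_single_of_not K h]
      exact zero_mem _

theorem retract_mem_reduced {k : ℕ} {T : Finset (Fin n)} (i : Fin n) {f : FreePairs n K}
    (hf : f ∈ reduced K Δ k T) : retract K i f ∈ reduced K Δ k (insert i T) := by
  refine reduced_induction (P := fun f => retract K i f ∈ reduced K Δ k (insert i T))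
    (by simp [retract]) (fun f g hf hg => ?_) (fun q c hq hc => ?_) hf
  · have : retract K i (f + g) = retract K i f + retract K i g := by
      simp only [retract, map_add]
      abel
    rw [this]
    exact add_mem hf hg
  · by_cases h1 : i ∈ q.1
    · by_cases h2 : i ∈ q.2
      · rw [retract_single_of_mem_inter K h1 h2]
        exact zero_mem _
      · rw [retract_single_of_mem_sdiff K h1 h2]
        refine add_mem (single_mem_reduced (hq.shift h1 h2) fun j hj hj1 => ?_)
          (single_mem_reduced hq fun j hj hj1 => ?_)
        · simp only [Finset.mem_erase] at hj1
          have hjT := Finset.mem_of_mem_insert_of_ne hj hj1.1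
          refine ⟨by simp [hj1.1, (hc j hjT hj1.2).1], ?_⟩
          rw [divY_mul_x, divY_comm, (hc j hjT hj1.2).2, map_zero, zero_mul]
        · by_cases hji : j = i
          · subst hji
            exact ⟨h2, by rw [map_sub, divY_mul_y_self, sub_self]⟩
          · obtain ⟨hj2, hjc⟩ := hc j (Finset.mem_of_mem_insert_of_ne hj hji) hj1
            refine ⟨hj2, ?_⟩
            rw [map_sub, divY_mul_y K (Ne.symm hji), divY_comm, hjc, map_zero, zero_mul, sub_zero]
    · rw [retract_single_of_notMem K h1]
      refine single_mem_reduced hq fun j hj hj1 => ?_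
      exact hc j (Finset.mem_of_mem_insert_of_ne hj fun h => h1 (h ▸ hj1)) hj1

/-- Every cycle of `F_{k+1}` is homologous to a reduced one. -/
theorem exists_sub_del_mem_reduced {k : ℕ} {z : FreePairs n K} (hz : z ∈ reduced K Δ k ∅)
    (hdz : del K z = 0) (T : Finset (Fin n)) :
    ∃ w ∈ reduced K Δ (k + 1) ∅, z - del K w ∈ reduced K Δ k T := by
  induction T using Finset.induction_on with
  | empty => exact ⟨0, zero_mem _, by simpa using hz⟩
  | insert i T _ ih =>
    obtain ⟨w, hw, hzw⟩ := ih
    refine ⟨w + homotopy K i (z - del K w), add_mem hw (homotopy_mem_reduced i hzw), ?_⟩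
    have h : z - del K (w + homotopy K i (z - del K w)) = retract K i (z - del K w) := by
      have hd : del K (z - del K w) = 0 := by rw [map_sub, hdz, del_del, sub_zero]
      rw [retract, hd, map_zero, sub_zero, map_add, sub_sub]
    rw [h]
    exact retract_mem_reduced i hzw

/-- A fully reduced element of `F_{k+1}` with `k ≥ 1` is zero, as every `e_{G,H}` there has
`G ∩ H ≠ ∅`. -/
theorem eq_zero_of_mem_reduced_succ {k : ℕ} {z : FreePairs n K}
    (hz : z ∈ reduced K Δ (k + 1) Finset.univ) : z = 0 := by
  refine reduced_induction (P := fun f => f = 0) rfl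
    (fun f g hf hg => by rw [hf, hg, add_zero]) (fun q c hq hc => ?_) hz
  have hpos : 0 < (q.1 ∩ q.2).card := by rw [hq.card_inter]; exact Nat.succ_pos k
  obtain ⟨i, hi⟩ := Finset.card_pos.mp hpos
  rw [Finset.mem_inter] at hi
  exact absurd hi.2 (hc i (Finset.mem_univ i) hi.1).1

/-- The exponent vector of `x_G y_H`. -/
noncomputable def expo (q : Finset (Fin n) × Finset (Fin n)) : Fin n ⊕ Fin n →₀ ℕ :=
  ∑ i ∈ q.1, Finsupp.single (Sum.inl i) 1 + ∑ i ∈ q.2, Finsupp.single (Sum.inr i) 1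

theorem expo_inr (q : Finset (Fin n) × Finset (Fin n)) (i : Fin n) :
    expo q (Sum.inr i) = if i ∈ q.2 then 1 else 0 := by
  simp [expo, Finsupp.single_apply]

theorem xMon_mul_yMon (q : Finset (Fin n) × Finset (Fin n)) :
    xMon K q.1 * yMon K q.2 = MvPolynomial.monomial (expo q) 1 := by
  simp only [xMon, yMon, x, y, MvPolynomial.X, expo]
  rw [← MvPolynomial.monomial_sum_one, ← MvPolynomial.monomial_sum_one,
    MvPolynomial.monomial_mul, one_mul]

theorem coeff_eq_zero_of_divY_eq_zero {i : Fin n} {c : Poly n K} (h : divY K i c = 0)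
    {m : Fin n ⊕ Fin n →₀ ℕ} (hm : m (Sum.inr i) ≠ 0) : c.coeff m = 0 := by
  have hle : Finsupp.single (Sum.inr i) 1 ≤ m :=
    Finsupp.single_le_iff.mpr (Nat.one_le_iff_ne_zero.mpr hm)
  rw [← add_tsub_cancel_of_le hle, ← coeff_divY, h, MvPolynomial.coeff_zero]

/-- On fully reduced elements of `F_1` the map `∂_1` is injective: a term `m e_{G,H}` goes to the
monomial `m x_G y_H`, where `H = [n] \ G` is the set of all `i` such that `y_i` divides it. -/
theorem eq_zero_of_mem_reduced_zero {z : FreePairs n K} (hz : z ∈ reduced K Δ 0 Finset.univ)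
    (he : eps K z = 0) : z = 0 := by
  by_contra hne
  obtain ⟨q, hq⟩ := Finsupp.ne_iff.mp hne
  rw [Finsupp.zero_apply] at hq
  obtain ⟨m, hm⟩ := MvPolynomial.ne_zero_iff.mp hq
  have hpair : ∀ q', z q' ≠ 0 → ∀ i, i ∈ q'.1 ↔ i ∉ q'.2 := by
    intro q' hq' i
    have hP : IsPair Δ 0 q' := not_not.mp fun h => hq' ((hz q').1 h)
    constructor
    · exact fun h1 h2 => hq' (((hz q').2 i (Finset.mem_univ i) h1).1 h2)
    · intro h2
      have : i ∈ q'.1 ∪ q'.2 := hP.union ▸ Finset.mem_univ i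
      exact (Finset.mem_union.mp this).resolve_right h2
  have hmy : ∀ i, i ∉ q.2 → m (Sum.inr i) = 0 := by
    intro i hi
    by_contra h
    exact hm (coeff_eq_zero_of_divY_eq_zero
      ((hz q).2 i (Finset.mem_univ i) ((hpair q hq i).mpr hi)).2 h)
  refine hm ?_
  have hcoeff := congrArg (MvPolynomial.coeff (m + expo q)) he
  rw [eps, Finsupp.linearCombination_apply, Finsupp.sum, MvPolynomial.coeff_sum,
    Finset.sum_eq_single_of_mem q (Finsupp.mem_support_iff.mpr hq)] at hcoeff
  · simpa only [xMon_mul_yMon, smul_eq_mul, MvPolynomial.coeff_mul_monomial, mul_one,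
      MvPolynomial.coeff_zero] using hcoeff
  · intro q' hq' hqq
    rw [Finsupp.mem_support_iff] at hq'
    rw [xMon_mul_yMon, smul_eq_mul, MvPolynomial.coeff_mul_monomial', mul_one]
    split_ifs with hle
    · -- Both `H'` and `H` are read off from the `y`-exponents of the common monomial.
      by_contra hc
      have h2 : q'.2 = q.2 := by
        ext i
        constructor
        · intro hi
          by_contra hi'
          have := hle (Sum.inr i)
          rw [Finsupp.add_apply, expo_inr, expo_inr, if_pos hi, if_neg hi', hmy i hi'] at this
          omega
        · intro hi
          by_contra hi'
          refine hc (coeff_eq_zero_of_divY_eq_zero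
            ((hz q').2 i (Finset.mem_univ i) ((hpair q' hq' i).mpr hi')).2 ?_)
          rw [Finsupp.tsub_apply, Finsupp.add_apply, expo_inr, expo_inr, if_pos hi, if_neg hi']
          omega
      refine hqq (Prod.ext ?_ h2)
      ext i
      rw [hpair q' hq', hpair q hq, h2]
    · rfl

variable (K Δ)

/-! ### Exactness -/

theorem pair_injective (k : ℕ) : Function.Injective fun p : Pair Δ k => (p.G, p.H) := by
  rintro ⟨G, H⟩ ⟨G', H'⟩ h
  simp only [Prod.mk.injEq] at h
  obtain ⟨rfl, rfl⟩ := h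
  rfl

/-- The inclusion of `F_{k+1}` in the free module on all pairs. -/
noncomputable def incl (k : ℕ) : (Pair Δ k →₀ Poly n K) →ₗ[Poly n K] FreePairs n K :=
  Finsupp.lmapDomain _ _ fun p => (p.G, p.H)

theorem incl_injective (k : ℕ) : Function.Injective (incl K Δ k) :=
  Finsupp.mapDomain_injective (pair_injective Δ k)

theorem incl_single {k : ℕ} (p : Pair Δ k) (c : Poly n K) :
    incl K Δ k (Finsupp.single p c) = Finsupp.single (p.G, p.H) c :=
  Finsupp.mapDomain_single

theorem incl_mem_reduced {k : ℕ} (f : Pair Δ k →₀ Poly n K) :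
    incl K Δ k f ∈ reduced K Δ k ∅ := by
  induction f using Finsupp.induction_linear with
  | zero => rw [map_zero]; exact zero_mem _
  | add f g hf hg => rw [map_add]; exact add_mem hf hg
  | single p c =>
    rw [incl_single]
    exact single_mem_reduced ⟨p.memG, p.memH, p.card_inter, p.union⟩ (by simp)

theorem exists_incl_eq {k : ℕ} {T : Finset (Fin n)} {f : FreePairs n K}
    (hf : f ∈ reduced K Δ k T) : ∃ g, incl K Δ k g = f := by
  refine reduced_induction (P := fun f => ∃ g, incl K Δ k g = f) ⟨0, map_zero _⟩
    ?_ (fun q c hq _ => ?_) hf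
  · rintro f g ⟨f', rfl⟩ ⟨g', rfl⟩
    exact ⟨f' + g', map_add _ _ _⟩
  · exact ⟨Finsupp.single ⟨q.1, q.2, hq.memG, hq.memH, hq.card_inter, hq.union⟩ c,
      incl_single K Δ _ c⟩

theorem incl_boundarySucc {k : ℕ} (f : Pair Δ (k + 1) →₀ Poly n K) :
    incl K Δ k (boundarySucc K Δ k f) = del K (incl K Δ (k + 1) f) := by
  induction f using Finsupp.induction_linear with
  | zero => simp
  | add f g hf hg => simp only [map_add, hf, hg]
  | single p c =>
    rw [incl_single, boundarySucc, Finsupp.linearCombination_single, map_smul, map_sum, del,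
      Finsupp.linearCombination_single]
    congr 1
    rw [← Finset.sum_coe_sort (p.G ∩ p.H)]
    refine Finset.sum_congr rfl fun i _ => ?_
    rw [map_smul, map_sub, map_smul, map_smul, e, e, incl_single, incl_single]
    have hs : ((-1 : Poly n K) ^ sigma (p.G ∩ p.H) i.1) =
        ((sgn (p.G ∩ p.H) i.1 : ℤ) : Poly n K) := by
      simp [sgn]
    rw [hs, Int.cast_smul_eq_zsmul, face, Finsupp.smul_single, Finsupp.smul_single]
    simp [Pair.eraseLeft, Pair.eraseRight]

theorem eps_incl (f : Pair Δ 0 →₀ Poly n K) : eps K (incl K Δ 0 f) = boundaryOne K Δ f := by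
  induction f using Finsupp.induction_linear with
  | zero => simp
  | add f g hf hg => simp only [map_add, hf, hg]
  | single p c => rw [incl_single, eps_single, boundaryOne, Finsupp.linearCombination_single,
      smul_eq_mul]

theorem exact_boundarySucc (k : ℕ) :
    Function.Exact (boundarySucc K Δ (k + 1)) (boundarySucc K Δ k) := by
  intro z
  constructor
  · intro hz
    have hdz : del K (incl K Δ (k + 1) z) = 0 := by rw [← incl_boundarySucc, hz, map_zero]
    obtain ⟨w, hw, hzw⟩ :=
      exists_sub_del_mem_reduced (incl_mem_reduced K Δ z) hdz Finset.univ
    obtain ⟨g, rfl⟩ := exists_incl_eq K Δ hw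
    refine ⟨g, incl_injective K Δ _ ?_⟩
    rw [incl_boundarySucc]
    exact (sub_eq_zero.mp (eq_zero_of_mem_reduced_succ hzw)).symm
  · rintro ⟨w, rfl⟩
    apply incl_injective K Δ
    rw [incl_boundarySucc, incl_boundarySucc, del_del, map_zero]

theorem exact_boundaryOne : Function.Exact (boundarySucc K Δ 0) (boundaryOne K Δ) := by
  intro z
  constructor
  · intro hz
    have hdz : del K (incl K Δ 0 z) = 0 := by
      -- On `F_1` the sums that define `del` are empty.
      refine reduced_induction (P := fun f => del K f = 0) (map_zero _)
        (fun f g hf hg => by rw [map_add, hf, hg, add_zero]) (fun q c hq _ => ?_)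
        (incl_mem_reduced K Δ z)
      rw [del_single, Finset.card_eq_zero.mp hq.card_inter, Finset.sum_empty]
    obtain ⟨w, hw, hzw⟩ :=
      exists_sub_del_mem_reduced (incl_mem_reduced K Δ z) hdz Finset.univ
    obtain ⟨g, rfl⟩ := exists_incl_eq K Δ hw
    refine ⟨g, incl_injective K Δ _ ?_⟩
    rw [incl_boundarySucc]
    refine (sub_eq_zero.mp (eq_zero_of_mem_reduced_zero hzw ?_)).symm
    rw [map_sub, eps_del, eps_incl, hz, sub_zero]
  · rintro ⟨w, rfl⟩
    rw [← eps_incl, incl_boundarySucc, eps_del]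

theorem range_boundaryOne : LinearMap.range (boundaryOne K Δ) = faceIdeal K Δ := by
  rw [boundaryOne, Finsupp.range_linearCombination, faceIdeal, Ideal.span]
  congr 1
  ext u
  constructor
  · rintro ⟨p, rfl⟩
    refine ⟨p.G, p.memG, ?_⟩
    have hH : p.H = Finset.univ \ p.G := by
      have hd : Disjoint p.G p.H :=
        Finset.disjoint_iff_inter_eq_empty.mpr (Finset.card_eq_zero.mp p.card_inter)
      rw [← p.union, Finset.union_sdiff_cancel_left hd]
    simp only [← hH]
  · rintro ⟨G, hG, rfl⟩
    exact ⟨⟨G, Finset.univ \ G, hG, (Complex.mem_complements Δ).mpr (by simpa using hG),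
      by simp, by simp⟩, rfl⟩

theorem exact_augmentation : Function.Exact (boundaryOne K Δ) (Submodule.mkQ (faceIdeal K Δ)) := by
  rw [LinearMap.exact_iff, Submodule.ker_mkQ, range_boundaryOne]

end Exactness

section Graded

/-! ### Gradings -/

/-- A family of subgroups is an internal direct sum if there are projections on its members which
recover every element as a finite sum. -/
theorem isInternal_of_projections {M : Type*} [AddCommGroup M] (ℳ : ℕ → AddSubgroup M)
    (p : ℕ → M →+ M) (mem : ∀ m f, p m f ∈ ℳ m) (same : ∀ m, ∀ f ∈ ℳ m, p m f = f)
    (ne : ∀ m m', m ≠ m' → ∀ f ∈ ℳ m', p m f = 0)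
    (sum : ∀ f, ∃ s : Finset ℕ, f = ∑ m ∈ s, p m f) : DirectSum.IsInternal ℳ := by
  have key : ∀ (m : ℕ) (v : DirectSum ℕ fun m => ℳ m),
      p m (DirectSum.coeAddMonoidHom ℳ v) = v m := by
    intro m v
    induction v using DirectSum.induction_on with
    | zero => simp
    | add v w hv hw => rw [map_add, map_add, hv, hw]; rfl
    | of i f =>
      rw [DirectSum.coeAddMonoidHom_of]
      by_cases h : m = i
      · subst h
        rw [same m f f.2, DirectSum.of_eq_same]
      · rw [ne m i h f f.2, DirectSum.of_eq_of_ne _ _ _ h]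
        rfl
  constructor
  · intro v w h
    ext m
    rw [← key, ← key, h]
  · intro f
    obtain ⟨s, hs⟩ := sum f
    refine ⟨∑ m ∈ s, DirectSum.of (fun m => ℳ m) m ⟨p m f, mem m f⟩, ?_⟩
    rw [map_sum]
    conv_rhs => rw [hs]
    exact Finset.sum_congr rfl fun m _ => DirectSum.coeAddMonoidHom_of ℳ m _

variable {n : ℕ} (K : Type*) [Field K] (Δ : Complex n)

theorem mem_polyGrading {m : ℕ} {f : Poly n K} : f ∈ polyGrading K n m ↔ f.IsHomogeneous m :=
  Iff.rfl

theorem mul_mem_polyGrading {i j m : ℕ} {f g : Poly n K} (hf : f ∈ polyGrading K n i)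
    (hg : g ∈ polyGrading K n j) (h : i + j = m) : f * g ∈ polyGrading K n m := by
  subst h
  exact MvPolynomial.IsHomogeneous.mul hf hg

theorem isGradedModule_poly : IsGradedModule (polyGrading K n) (polyGrading K n) where
  smul_mem _ _ _ _ hs hm := mul_mem_polyGrading K hs hm rfl
  isInternal := by
    refine isInternal_of_projections _
      (fun m => (MvPolynomial.homogeneousComponent m).toAddMonoidHom)
      (fun m f => MvPolynomial.homogeneousComponent_isHomogeneous m f)
      (fun m f hf => MvPolynomial.homogeneousComponent_eq_self hf)
      (fun m m' h f hf => ?_)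
      (fun f => ⟨Finset.range (f.totalDegree + 1), (MvPolynomial.sum_homogeneousComponent f).symm⟩)
    exact (MvPolynomial.homogeneousComponent_of_mem hf).trans (if_neg h)

/-- The projection of `S(-a)` on its component of degree `m`. -/
noncomputable def shiftedComponent (a m : ℕ) : Poly n K →+ Poly n K :=
  if a ≤ m then (MvPolynomial.homogeneousComponent (m - a)).toAddMonoidHom else 0

theorem shiftedComponent_mem (a m : ℕ) (f : Poly n K) :
    shiftedComponent K a m f ∈ shiftedGrading K n a m := by
  unfold shiftedComponent shiftedGrading
  split_ifs
  · exact MvPolynomial.homogeneousComponent_isHomogeneous _ f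
  · exact zero_mem _

theorem shiftedComponent_same {a m : ℕ} {f : Poly n K} (hf : f ∈ shiftedGrading K n a m) :
    shiftedComponent K a m f = f := by
  unfold shiftedComponent
  unfold shiftedGrading at hf
  split_ifs at hf ⊢
  · exact MvPolynomial.homogeneousComponent_eq_self hf
  · exact (AddSubgroup.mem_bot.mp hf).symm

theorem shiftedComponent_ne {a m m' : ℕ} (h : m ≠ m') {f : Poly n K}
    (hf : f ∈ shiftedGrading K n a m') : shiftedComponent K a m f = 0 := by
  unfold shiftedGrading at hf
  split_ifs at hf with h'
  · unfold shiftedComponent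
    split_ifs with h2
    · exact (MvPolynomial.homogeneousComponent_of_mem hf).trans (if_neg (by omega))
    · rfl
  · rw [AddSubgroup.mem_bot.mp hf, map_zero]

theorem sum_shiftedComponent {a N : ℕ} {f : Poly n K} (hN : a + f.totalDegree < N) :
    ∑ m ∈ Finset.range N, shiftedComponent K a m f = f := by
  obtain ⟨M, rfl⟩ : ∃ M, N = a + (f.totalDegree + 1) + M := ⟨N - (a + f.totalDegree + 1), by omega⟩
  rw [add_assoc, Finset.sum_range_add, Finset.sum_eq_zero, zero_add, Finset.sum_range_add]
  · conv_rhs => rw [← MvPolynomial.sum_homogeneousComponent f]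
    rw [Finset.sum_congr rfl (g := fun m => MvPolynomial.homogeneousComponent m f), add_eq_left]
    · refine Finset.sum_eq_zero fun m _ => ?_
      simp only [shiftedComponent, Nat.le_add_right, if_true, Nat.add_sub_cancel_left]
      exact MvPolynomial.homogeneousComponent_eq_zero _ _ (by omega)
    · intro m _
      simp only [shiftedComponent, Nat.le_add_right, if_true, Nat.add_sub_cancel_left]
      rfl
  · intro m hm
    rw [shiftedComponent, if_neg (by simpa using hm), AddMonoidHom.zero_apply]

theorem mul_mem_shiftedGrading {a i j : ℕ} {f g : Poly n K} (hf : f ∈ polyGrading K n i)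
    (hg : g ∈ shiftedGrading K n a j) : f * g ∈ shiftedGrading K n a (i + j) := by
  unfold shiftedGrading at hg ⊢
  split_ifs at hg with h
  · rw [if_pos (by omega)]
    exact mul_mem_polyGrading K hf hg (by omega)
  · rw [AddSubgroup.mem_bot.mp hg, mul_zero]
    exact zero_mem _

theorem mul_mem_shiftedGrading_of_eq {a b c m : ℕ} {f g : Poly n K}
    (hf : f ∈ shiftedGrading K n a m) (hg : g ∈ polyGrading K n c) (h : b + c = a) :
    f * g ∈ shiftedGrading K n b m := by
  unfold shiftedGrading at hf ⊢
  split_ifs at hf with ham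
  · rw [if_pos (by omega)]
    exact mul_mem_polyGrading K hf hg (by omega)
  · rw [AddSubgroup.mem_bot.mp hf, zero_mul]
    exact zero_mem _

/-- The projection of `F_{k+1}` on its component of degree `m`. -/
noncomputable def pairComponent (k m : ℕ) : (Pair Δ k →₀ Poly n K) →+ (Pair Δ k →₀ Poly n K) :=
  Finsupp.liftAddHom fun p =>
    (Finsupp.singleAddHom p).comp (shiftedComponent K (p.G.card + p.H.card) m)

theorem pairComponent_apply {k : ℕ} (m : ℕ) (f : Pair Δ k →₀ Poly n K) (p : Pair Δ k) :
    pairComponent K Δ k m f p = shiftedComponent K (p.G.card + p.H.card) m (f p) := by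
  induction f using Finsupp.induction_linear with
  | zero => simp
  | add f g hf hg => rw [map_add, Finsupp.add_apply, hf, hg, Finsupp.add_apply, map_add]
  | single q c =>
    rw [pairComponent, Finsupp.liftAddHom_apply_single]
    simp only [AddMonoidHom.comp_apply, Finsupp.singleAddHom_apply]
    by_cases h : q = p
    · subst h
      rw [Finsupp.single_eq_same, Finsupp.single_eq_same]
    · rw [Finsupp.single_eq_of_ne (Ne.symm h), Finsupp.single_eq_of_ne (Ne.symm h), map_zero]

theorem isGradedModule_pair (k : ℕ) : IsGradedModule (polyGrading K n) (pairGrading K Δ k) where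
  smul_mem _ _ _ _ hs hm p := mul_mem_shiftedGrading K hs (hm p)
  isInternal := by
    refine isInternal_of_projections _ (pairComponent K Δ k) (fun m f p => ?_) (fun m f hf => ?_)
      (fun m m' h f hf => ?_) (fun f => ?_)
    · rw [pairComponent_apply]
      exact shiftedComponent_mem K _ _ _
    · ext1 p
      rw [pairComponent_apply, shiftedComponent_same K (hf p)]
    · ext1 p
      rw [pairComponent_apply, shiftedComponent_ne K h (hf p), Finsupp.zero_apply]
    · refine ⟨Finset.range
        (f.support.sup (fun p => p.G.card + p.H.card + (f p).totalDegree) + 1), ?_⟩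
      ext1 p
      rw [Finsupp.finsetSum_apply]
      simp only [pairComponent_apply]
      by_cases hp : f p = 0
      · simp [hp]
      · refine (sum_shiftedComponent K (Nat.lt_succ_of_le ?_)).symm
        exact Finset.le_sup (f := fun p => p.G.card + p.H.card + (f p).totalDegree)
          (Finsupp.mem_support_iff.mpr hp)

theorem x_mem (i : Fin n) : x K i ∈ polyGrading K n 1 := MvPolynomial.isHomogeneous_X _ _

theorem y_mem (i : Fin n) : y K i ∈ polyGrading K n 1 := MvPolynomial.isHomogeneous_X _ _

theorem xMon_mul_yMon_mem (G H : Finset (Fin n)) :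
    xMon K G * yMon K H ∈ polyGrading K n (G.card + H.card) := by
  refine mul_mem_polyGrading K (i := G.card) (j := H.card) ?_ ?_ rfl
  · have := MvPolynomial.IsHomogeneous.prod G (x K) (fun _ => 1) fun i _ => x_mem K i
    simpa [mem_polyGrading, xMon] using this
  · have := MvPolynomial.IsHomogeneous.prod H (y K) (fun _ => 1) fun i _ => y_mem K i
    simpa [mem_polyGrading, yMon] using this

theorem homogeneousComponent_mem_faceIdeal {f : Poly n K} (hf : f ∈ faceIdeal K Δ) (m : ℕ) :
    MvPolynomial.homogeneousComponent m f ∈ faceIdeal K Δ := by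
  let _ := MvPolynomial.gradedAlgebra (σ := Fin n ⊕ Fin n) (R := K)
  refine MvPolynomial.homogeneousComponent_mem_of_mem 
    (Ideal.homogeneous_span (MvPolynomial.homogeneousSubmodule (Fin n ⊕ Fin n) K) _ ?_) hf m
  rintro _ ⟨F, _, rfl⟩
  exact ⟨_, xMon_mul_yMon_mem K F _⟩

theorem isGradedModule_quotient : IsGradedModule (polyGrading K n) (quotientGrading K Δ) where
  smul_mem := by
    rintro i j s _ hs ⟨m, hm, rfl⟩
    exact ⟨s * m, mul_mem_polyGrading K hs hm rfl, rfl⟩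
  isInternal := by
    refine isInternal_of_projections _
      (fun m => QuotientAddGroup.map (faceIdeal K Δ).toAddSubgroup (faceIdeal K Δ).toAddSubgroup
        (MvPolynomial.homogeneousComponent m).toAddMonoidHom
        fun f hf => homogeneousComponent_mem_faceIdeal K Δ hf m) ?_ ?_ ?_ ?_
    · rintro m ⟨f⟩
      exact ⟨_, MvPolynomial.homogeneousComponent_isHomogeneous m f, rfl⟩
    · rintro m _ ⟨f, hf, rfl⟩
      exact congrArg (Submodule.mkQ (faceIdeal K Δ)) (MvPolynomial.homogeneousComponent_eq_self hf)
    · rintro m m' h _ ⟨f, hf, rfl⟩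
      exact congrArg (Submodule.mkQ (faceIdeal K Δ))
        ((MvPolynomial.homogeneousComponent_of_mem hf).trans (if_neg h))
    · rintro ⟨f⟩
      refine ⟨Finset.range (f.totalDegree + 1), ?_⟩
      refine (congrArg (Submodule.mkQ (faceIdeal K Δ))
        (MvPolynomial.sum_homogeneousComponent f).symm).trans ?_
      rw [map_sum]
      rfl

variable {K Δ}

theorem single_mem_pairGrading {k m : ℕ} {p : Pair Δ k} {c : Poly n K}
    (hc : c ∈ shiftedGrading K n (p.G.card + p.H.card) m) :
    Finsupp.single p c ∈ pairGrading K Δ k m := by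
  intro q
  by_cases h : p = q
  · subst h
    rwa [Finsupp.single_eq_same]
  · rw [Finsupp.single_eq_of_ne (Ne.symm h)]
    exact zero_mem _

variable (K Δ)

theorem e_mem_pairGrading {k : ℕ} (p : Pair Δ k) :
    e K Δ p ∈ pairGrading K Δ k (p.G.card + p.H.card) := by
  refine single_mem_pairGrading ?_
  rw [shiftedGrading, if_pos le_rfl, Nat.sub_self]
  exact MvPolynomial.isHomogeneous_one _ _

theorem boundaryOne_mem (m : ℕ) (f : Pair Δ 0 →₀ Poly n K) (hf : f ∈ pairGrading K Δ 0 m) :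
    boundaryOne K Δ f ∈ polyGrading K n m := by
  rw [boundaryOne, Finsupp.linearCombination_apply]
  refine sum_mem fun p _ => ?_
  have := mul_mem_shiftedGrading_of_eq K (b := 0) (hf p) (xMon_mul_yMon_mem K p.G p.H)
    (zero_add _)
  simpa [shiftedGrading] using this

theorem boundarySucc_mem (k m : ℕ) (f : Pair Δ (k + 1) →₀ Poly n K)
    (hf : f ∈ pairGrading K Δ (k + 1) m) : boundarySucc K Δ k f ∈ pairGrading K Δ k m := by
  rw [boundarySucc, Finsupp.linearCombination_apply]
  refine sum_mem fun p _ => ?_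
  simp only [Finset.smul_sum]
  refine sum_mem fun i _ => ?_
  have hi := Finset.mem_inter.mp i.2
  have hG := Finset.card_erase_add_one hi.1
  have hH := Finset.card_erase_add_one hi.2
  rw [smul_comm]
  have hmem : f p • (x K i.1 • e K Δ (p.eraseLeft i.1 i.2) -
      y K i.1 • e K Δ (p.eraseRight i.1 i.2)) ∈ pairGrading K Δ k m := by
    rw [smul_sub, smul_smul, smul_smul, e, e, Finsupp.smul_single, Finsupp.smul_single,
      smul_eq_mul, smul_eq_mul, mul_one, mul_one]
    refine sub_mem (single_mem_pairGrading ?_) (single_mem_pairGrading ?_)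
    · refine mul_mem_shiftedGrading_of_eq K (hf p) (x_mem K i.1) ?_
      simp only [Pair.eraseLeft]
      omega
    · refine mul_mem_shiftedGrading_of_eq K (hf p) (y_mem K i.1) ?_
      simp only [Pair.eraseRight]
      omega
  rcases neg_one_pow_eq_or (Poly n K) (sigma (p.G ∩ p.H) i.1) with h | h
  · rwa [h, one_smul]
  · rw [h, neg_smul, one_smul]
    exact neg_mem hmem

end Graded

section Resolution

/-! ### The resolution and its minimality -/

variable {n : ℕ} (K : Type*) [Field K] (Δ : Complex n)

instance finite_pair (k : ℕ) : Finite (Pair Δ k) :=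
  Finite.of_injective _ (pair_injective Δ k)

theorem exists_homogeneous_basis (k : ℕ) :
    ∃ (r : ℕ) (b : Module.Basis (Fin r) (Poly n K) (Pair Δ k →₀ Poly n K)) (deg : Fin r → ℕ),
      ∀ i, b i ∈ pairGrading K Δ k (deg i) := by
  let φ := Finite.equivFin (Pair Δ k)
  refine ⟨_, Finsupp.basisSingleOne.reindex φ,
    fun i => (φ.symm i).G.card + (φ.symm i).H.card, fun i => ?_⟩
  rw [Module.Basis.reindex_apply, Finsupp.coe_basisSingleOne]
  exact e_mem_pairGrading K Δ _

theorem exists_homogeneous_basis_poly :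
    ∃ (r : ℕ) (b : Module.Basis (Fin r) (Poly n K) (Poly n K)) (deg : Fin r → ℕ),
      ∀ i, b i ∈ polyGrading K n (deg i) := by
  refine ⟨1, Module.Basis.singleton (Fin 1) (Poly n K), fun _ => 0, fun i => ?_⟩
  rw [Module.Basis.singleton_apply]
  exact MvPolynomial.isHomogeneous_one _ _

theorem isGradedFreeResolution : IsGradedFreeResolution (polyGrading K n) (grading K Δ)
    (boundary K Δ) (quotientGrading K Δ) (augmentation K Δ) where
  graded_target := isGradedModule_quotient K Δ
  graded
    | 0 => isGradedModule_poly K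
    | k + 1 => isGradedModule_pair K Δ k
  free
    | 0 => exists_homogeneous_basis_poly K
    | k + 1 => exists_homogeneous_basis K Δ k
  boundary_mem
    | 0 => boundaryOne_mem K Δ
    | k + 1 => boundarySucc_mem K Δ k
  augmentation_mem _ f hf := ⟨f, hf, rfl⟩
  exact
    | 0 => exact_boundaryOne K Δ
    | k + 1 => exact_boundarySucc K Δ k
  exact_zero := exact_augmentation K Δ
  surjective := Submodule.mkQ_surjective (faceIdeal K Δ)

theorem isEmpty_pair {k : ℕ} (hk : Δ.faces.sup Finset.card < k) : IsEmpty (Pair Δ k) := by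
  refine ⟨fun p => ?_⟩
  have h1 : p.G.card ≤ Δ.faces.sup Finset.card := Finset.le_sup p.memG
  have h2 := Finset.card_le_card (Finset.inter_subset_left (s₁ := p.G) (s₂ := p.H))
  rw [p.card_inter] at h2
  omega

theorem x_mem_maxIdeal (i : Fin n) : x K i ∈ maxIdeal K n :=
  Ideal.subset_span (Or.inl ⟨i, rfl⟩)

theorem y_mem_maxIdeal (i : Fin n) : y K i ∈ maxIdeal K n :=
  Ideal.subset_span (Or.inr ⟨i, rfl⟩)

theorem range_boundaryOne_le (hn : 0 < n) : LinearMap.range (boundaryOne K Δ) ≤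
    maxIdeal K n • (⊤ : Submodule (Poly n K) (Poly n K)) := by
  rw [boundaryOne, Finsupp.range_linearCombination, Submodule.span_le]
  rintro _ ⟨p, rfl⟩
  rw [SetLike.mem_coe, smul_eq_mul, Ideal.mul_top]
  have h : (⟨0, hn⟩ : Fin n) ∈ p.G ∪ p.H := p.union ▸ Finset.mem_univ _
  rcases Finset.mem_union.mp h with h | h
  · exact Ideal.mul_mem_right _ _
      (Ideal.mem_of_dvd _ (Finset.dvd_prod_of_mem _ h) (x_mem_maxIdeal K _))
  · exact Ideal.mul_mem_left _ _
      (Ideal.mem_of_dvd _ (Finset.dvd_prod_of_mem _ h) (y_mem_maxIdeal K _))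

theorem range_boundarySucc_le (k : ℕ) : LinearMap.range (boundarySucc K Δ k) ≤
    maxIdeal K n • (⊤ : Submodule (Poly n K) (Pair Δ k →₀ Poly n K)) := by
  rw [boundarySucc, Finsupp.range_linearCombination, Submodule.span_le]
  rintro _ ⟨p, rfl⟩
  refine Submodule.sum_mem _ fun i _ => Submodule.smul_mem _ _ (Submodule.sub_mem _ ?_ ?_)
  · exact Submodule.smul_mem_smul (x_mem_maxIdeal K _) trivial
  · exact Submodule.smul_mem_smul (y_mem_maxIdeal K _) trivial

end Resolution

end FaceIdeal

theorem theorem1p3 {K : Type*} [Field K] {n : ℕ} (Δ : FaceIdeal.Complex n) (d : ℕ)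
    (hd : Δ.dim = (d : ℤ) - 1) :
    FaceIdeal.IsGradedFreeResolution (FaceIdeal.polyGrading K n)
        (FaceIdeal.grading K Δ) (FaceIdeal.boundary K Δ)
        (FaceIdeal.quotientGrading K Δ) (FaceIdeal.augmentation K Δ) ∧
      (∀ j, d + 1 < j → Subsingleton (FaceIdeal.F K Δ j)) ∧
      (0 < n → ∀ j, LinearMap.range (FaceIdeal.boundary K Δ j) ≤
        FaceIdeal.maxIdeal K n • (⊤ : Submodule (FaceIdeal.Poly n K) (FaceIdeal.F K Δ j))) := by
  refine ⟨FaceIdeal.isGradedFreeResolution K Δ, ?_, ?_⟩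
  · rintro (_ | k) hj
    · omega
    · have : IsEmpty (FaceIdeal.Pair Δ k) := by
        refine FaceIdeal.isEmpty_pair Δ ?_
        unfold FaceIdeal.Complex.dim at hd
        omega
      exact inferInstanceAs (Subsingleton (FaceIdeal.Pair Δ k →₀ FaceIdeal.Poly n K))
  · rintro hn (_ | k)
    · exact FaceIdeal.range_boundaryOne_le K Δ hn
    · exact FaceIdeal.range_boundarySucc_le K Δ k
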